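/- Fix a countably infinite set of names $a,b,c,\dots$ and a disjoint set of name variables $x,y,\dots$; let $n,m,p,q$ range over names and name variables. The terms of the $\pi$-calculus are $$S,T ::= \mathbf 0 \mid \sum_{i\in I} n(x).T_i \mid \sum_{i\in I}\overline n m_i.T_i \mid S\,|\,T \mid (c)T \mid [p{=}q]T \mid [p{\neq}q]T \mid\; !n(x).T \mid\; !\overline n m.T ,$$ with $I$ finite and nonempty; $x$ is bound in $n(x).T$ and $c$ in $(c)T$, and terms are identified up to renaming of bound names and variables. Processes are the terms without free name variables. Their labelled transitions $P\xrightarrow{\lambda}P'$, where $\lambda$ is an input $ab$, an output $\overline a b$, a bound output $\overline a(c)$ or the internal action $\tau$, are those of the usual early semantics: an input variable is replaced by the received name, $[a{=}a]T$ and, for distinct names $a,b$, $[a{\neq}b]T$ have the transitions of $T$, $!\pi.T$ behaves as $\pi.(T\,|\,!\pi.T)$, and a name variable can be neither a channel nor a message of a transition. The calculus $\pi^\vee$ is obtained from $\pi$ by replacing match and mismatch by the guards $[\varphi]T$, where $\varphi$ is any Boolean expression built from equalities $p{=}q$ by $\wedge$ and $\neg$; a process $[\varphi]T$ has the transitions of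 $T$ if $\varphi$ is true (distinct names being unequal) and none otherwise. Write $\Longrightarrow$ for the reflexive and transitive, $\Longrightarrow^{+}$ for the transitive closure of $\xrightarrow{\tau}$. A process $P$ is observable if $P\Longrightarrow P'\xrightarrow{\lambda}P''$ for some $P',P''$ and some $\lambda\neq\tau$. A relation $\mathcal R$ from the processes of a calculus $\mathbb L$ to those of a calculus $\mathbb M$ is * equipollent if $P\mathcal R Q$ implies that $P$ is observable iff $Q$ is; * extensional if $P\mathcal R Q$ and $P'\mathcal R Q'$ imply $(P|P')\mathcal R(Q|Q')$, and $P\mathcal R Q$ implies $(c)P\,\mathcal R\,(c)Q$ for every name $c$; * codivergent if, whenever $P\mathcal R Q$, for every infinite sequence $Q\xrightarrow{\tau}Q_1\xrightarrow{\tau}Q_2\xrightarrow{\tau}\cdots$ there are $k\ge1$ and $P'$ with $P\Longrightarrow^{+}P'\mathcal R Q_k$, and symmetrically; * a bisimulation if, whenever $P\mathcal R Q$ and $P\xrightarrow{\tau}P'$, either $Q\Longrightarrow Q'$ for some $Q'$ with $P\mathcal R Q'$ and $P'\mathcal R Q'$, or $Q\Longrightarrow Q''\xrightarrow{\tau}Q'$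 for some $Q'',Q'$ with $P\mathcal R Q''$ and $P'\mathcal R Q'$; and symmetrically. The absolute equality $=_{\mathbb M}$ is the largest reflexive, equipollent, extensional, codivergent bisimulation on the processes of $\mathbb M$. A subbisimilarity from $\mathbb L$ to $\mathbb M$ is an equipollent, extensional, codivergent bisimulation $\mathcal R$ from the processes of $\mathbb L$ to those of $\mathbb M$ that is total (every $P$ is related to some $Q$) and sound ($P_1\mathcal R Q_1$, $P_1=_{\mathbb L}P_2$ and $P_2\mathcal R Q_2$ imply $Q_1=_{\mathbb M}Q_2$). Write $\mathbb L\sqsubseteq\mathbb M$ if there is one. **Proposition.** $\pi\sqsubseteq\pi^\vee$ and $\pi^\vee\sqsubseteq\pi$. -/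

import Mathlib

namespace PiCalc

/-! ## Names, local names and name variables -/

/-- The countably infinite set of names. -/
abbrev Name : Type := ℕ

/-- What may stand in a name position of a term that lies under `k` localization binders and
`v` input binders: a global name, one of the `k` local names, or one of the `v` name variables.
The two kinds of binders are de Bruijn (the innermost one has index `0`), so that
terms are identified up to renaming of local names and bound name variables. -/
inductive Ref (k v : ℕ) : Type where
  | glob (a : Name) : Ref k v
  | loc (i : Fin k) : Ref k v
  | var (x : Fin v) : Ref k v

namespace Ref

/-- The global names of a reference. -/
def gn {k v : ℕ} : Ref k v → Finset Name
  | glob a => {a}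
  | loc _ => ∅
  | var _ => ∅

/-- Weakening under one more localization binder. -/
def wkLoc {k v : ℕ} : Ref k v → Ref (k + 1) v
  | glob a => glob a
  | loc i => loc i.succ
  | var x => var x

/-- Weakening under one more input binder. -/
def wkVar {k v : ℕ} : Ref k v → Ref k (v + 1)
  | glob a => glob a
  | loc i => loc i
  | var x => var x.succ

/-- Extend a map of references to the scope of one more localization binder. -/
def liftLoc {k v k' v' : ℕ} (ρ : Ref k v → Ref k' v') : Ref (k + 1) v → Ref (k' + 1) v'
  | glob a => (ρ (glob a)).wkLoc
  | loc i => Fin.cases (loc 0) (fun j => (ρ (loc j)).wkLoc) i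
  | var x => (ρ (var x)).wkLoc

/-- Extend a map of references to the scope of one more input binder. -/
def liftVar {k v k' v' : ℕ} (ρ : Ref k v → Ref k' v') : Ref k (v + 1) → Ref k' (v' + 1)
  | glob a => (ρ (glob a)).wkVar
  | loc i => (ρ (loc i)).wkVar
  | var x => Fin.cases (var 0) (fun j => (ρ (var j)).wkVar) x

/-- The substitution `{c/x}` of the name `c` for the outermost name variable `x` in scope. -/
def subst (c : Name) : Ref 0 1 → Ref 0 0
  | glob a => glob a
  | loc i => loc i
  | var _ => glob c

/-- Turn the global name `c` into the local name of a new localization binder. -/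
def bind (c : Name) : Ref 0 0 → Ref 1 0
  | glob a => if a = c then loc 0 else glob a
  | loc i => loc i.succ
  | var x => var x

end Ref

/-! ## Terms

The two calculi differ only in their guards, so terms are built over a language of guards. -/

/-- A language of guards: its syntax, the action of maps of references, the global names of a
guard, and the truth of a closed guard. It is used below for two concrete languages only. -/
structure GuardLang where
  Guard : ℕ → ℕ → Type
  map : ∀ {k v k' v' : ℕ}, (Ref k v → Ref k' v') → Guard k v → Guard k' v'
  gn : ∀ {k v : ℕ}, Guard k v → Finset Name
  Holds : Guard 0 0 → Prop

/-- Terms under `k` localization binders and with name variables among `v` given ones. -/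
inductive Term (G : GuardLang) : ℕ → ℕ → Type where
  /-- The process `0`. -/
  | nil {k v : ℕ} : Term G k v
  /-- The input choice `∑ i, n(x).T i` over a finite nonempty index set. -/
  | inSum {k v : ℕ} (r : ℕ) (n : Ref k v) (T : Fin (r + 1) → Term G k (v + 1)) : Term G k v
  /-- The output choice `∑ i, n̄ (m i).T i` over a finite nonempty index set. -/
  | outSum {k v : ℕ} (r : ℕ) (n : Ref k v) (m : Fin (r + 1) → Ref k v)
      (T : Fin (r + 1) → Term G k v) : Term G k v
  /-- The composition `S | T`. -/
  | par {k v : ℕ} (S T : Term G k v) : Term G k v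
  /-- Localization, in de Bruijn form; see `Proc.nu` for `(c)T`. -/
  | res {k v : ℕ} (T : Term G (k + 1) v) : Term G k v
  /-- The guarded term `[g]T`. -/
  | guard {k v : ℕ} (g : G.Guard k v) (T : Term G k v) : Term G k v
  /-- The replicated input `!n(x).T`. -/
  | repIn {k v : ℕ} (n : Ref k v) (T : Term G k (v + 1)) : Term G k v
  /-- The replicated output `!n̄m.T`. -/
  | repOut {k v : ℕ} (n m : Ref k v) (T : Term G k v) : Term G k v

namespace Term

variable {G : GuardLang}

/-- Apply a map of references to a term (capture avoiding). -/
def map {k v k' v' : ℕ} (ρ : Ref k v → Ref k' v') : Term G k v → Term G k' v'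
  | nil => nil
  | inSum r n T => inSum r (ρ n) fun i => (T i).map (Ref.liftVar ρ)
  | outSum r n m T => outSum r (ρ n) (fun i => ρ (m i)) fun i => (T i).map ρ
  | par S T => par (S.map ρ) (T.map ρ)
  | res T => res (T.map (Ref.liftLoc ρ))
  | guard g T => guard (G.map ρ g) (T.map ρ)
  | repIn n T => repIn (ρ n) (T.map (Ref.liftVar ρ))
  | repOut n m T => repOut (ρ n) (ρ m) (T.map ρ)

/-- The set of the global names of a term. -/
def gn {k v : ℕ} : Term G k v → Finset Name
  | nil => ∅
  | inSum _ n T => n.gn ∪ Finset.univ.biUnion fun i => (T i).gn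
  | outSum _ n m T =>
      n.gn ∪ (Finset.univ.biUnion fun i => (m i).gn) ∪ Finset.univ.biUnion fun i => (T i).gn
  | par S T => S.gn ∪ T.gn
  | res T => T.gn
  | guard g T => G.gn g ∪ T.gn
  | repIn n T => n.gn ∪ T.gn
  | repOut n m T => n.gn ∪ m.gn ∪ T.gn

end Term

/-- Processes are the closed terms: no free name variable (and no dangling local name). -/
abbrev Proc (G : GuardLang) : Type := Term G 0 0

/-- The localization `(c)P`. -/
def Proc.nu {G : GuardLang} (c : Name) (P : Proc G) : Proc G :=
  Term.res (Term.map (Ref.bind c) P)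

/-! ## Operational semantics -/

/-- Actions: input `ab`, output `āb`, bound output `ā(c)` and the internal action `τ`. -/
inductive Action : Type where
  | inp (a b : Name) : Action
  | out (a b : Name) : Action
  | bout (a c : Name) : Action
  | tau : Action

/-- The set of the names of an action. -/
def Action.names : Action → Finset Name
  | inp a b => {a, b}
  | out a b => {a, b}
  | bout a c => {a, c}
  | tau => ∅

/-- The set of the bound names of an action. -/
def Action.bn : Action → Finset Name
  | bout _ c => {c}
  | _ => ∅

/-- The labelled transition system. The disjointness conditions on the bound name of a bound
output spell out that local names are renamed away from the global names around them. -/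
inductive Step {G : GuardLang} : Proc G → Action → Proc G → Prop where
  | inp (r : ℕ) (a c : Name) (T : Fin (r + 1) → Term G 0 1) (i : Fin (r + 1)) :
      Step (.inSum r (.glob a) T) (.inp a c) ((T i).map (Ref.subst c))
  | out (r : ℕ) (a : Name) (c : Fin (r + 1) → Name) (T : Fin (r + 1) → Proc G)
      (i : Fin (r + 1)) :
      Step (.outSum r (.glob a) (fun j => .glob (c j)) T) (.out a (c i)) (T i)
  | parR (S T T' : Proc G) (l : Action) :
      Step T l T' → Disjoint l.bn S.gn → Step (.par S T) l (.par S T')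
  | parL (S S' T : Proc G) (l : Action) :
      Step S l S' → Disjoint l.bn T.gn → Step (.par S T) l (.par S' T)
  | comL (S S' T T' : Proc G) (a b : Name) :
      Step S (.inp a b) S' → Step T (.out a b) T' → Step (.par S T) .tau (.par S' T')
  | comR (S S' T T' : Proc G) (a b : Name) :
      Step S (.out a b) S' → Step T (.inp a b) T' → Step (.par S T) .tau (.par S' T')
  | closeL (S S' T T' : Proc G) (a c : Name) :
      Step S (.inp a c) S' → Step T (.bout a c) T' → c ∉ S.gn →
      Step (.par S T) .tau (Proc.nu c (.par S' T'))
  | closeR (S S' T T' : Proc G) (a c : Name) :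
      Step S (.bout a c) S' → Step T (.inp a c) T' → c ∉ T.gn →
      Step (.par S T) .tau (Proc.nu c (.par S' T'))
  | opn (T T' : Proc G) (a c : Name) :
      Step T (.out a c) T' → a ≠ c → Step (Proc.nu c T) (.bout a c) T'
  | res (T T' : Proc G) (c : Name) (l : Action) :
      Step T l T' → c ∉ l.names → Step (Proc.nu c T) l (Proc.nu c T')
  | guard (g : G.Guard 0 0) (T T' : Proc G) (l : Action) :
      G.Holds g → Step T l T' → Disjoint l.bn (G.gn g) → Step (.guard g T) l T'
  | repOut (a b : Name) (T : Proc G) :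
      Step (.repOut (.glob a) (.glob b) T) (.out a b)
        (.par T (.repOut (.glob a) (.glob b) T))
  | repIn (a b : Name) (T : Term G 0 1) :
      Step (.repIn (.glob a) T) (.inp a b)
        (.par (T.map (Ref.subst b)) (.repIn (.glob a) T))

/-! ## Absolute equality and subbisimilarity -/

/-- A name-passing calculus, as far as the definitions of absolute equality and of
subbisimilarity see it. -/
structure Calculus where
  Proc : Type
  Step : Proc → Action → Proc → Prop
  par : Proc → Proc → Proc
  nu : Name → Proc → Proc

namespace Calculus

/-- One internal step. -/
def Tau (M : Calculus) (P Q : M.Proc) : Prop := M.Step P Action.tau Q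

/-- `P ⟹ Q`: finitely many (possibly no) internal steps. -/
def Taus (M : Calculus) : M.Proc → M.Proc → Prop := Relation.ReflTransGen M.Tau

/-- `P ⟹ Q` with at least one internal step. -/
def TausPos (M : Calculus) : M.Proc → M.Proc → Prop := Relation.TransGen M.Tau

/-- `P` is observable: `P ⟹ ·` followed by an action other than `τ`. -/
def Observable (M : Calculus) (P : M.Proc) : Prop :=
  ∃ (P' P'' : M.Proc) (l : Action), M.Taus P P' ∧ l ≠ Action.tau ∧ M.Step P' l P''

/-- `f` is an infinite internal action sequence from `P`. -/
def InfSeq (M : Calculus) (P : M.Proc) (f : ℕ → M.Proc) : Prop :=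
  f 0 = P ∧ ∀ i, M.Tau (f i) (f (i + 1))

variable {L M : Calculus}

def Equipollent (R : L.Proc → M.Proc → Prop) : Prop :=
  ∀ P Q, R P Q → (L.Observable P ↔ M.Observable Q)

def Extensional (R : L.Proc → M.Proc → Prop) : Prop :=
  (∀ P Q P' Q', R P Q → R P' Q' → R (L.par P P') (M.par Q Q')) ∧
  (∀ (c : Name) P Q, R P Q → R (L.nu c P) (M.nu c Q))

def Codivergent (R : L.Proc → M.Proc → Prop) : Prop :=
  ∀ P Q, R P Q →
    (∀ f, M.InfSeq Q f → ∃ k ≥ 1, ∃ P', L.TausPos P P' ∧ R P' (f k)) ∧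
    (∀ f, L.InfSeq P f → ∃ k ≥ 1, ∃ Q', M.TausPos Q Q' ∧ R (f k) Q')

/-- The (branching) bisimulation property. -/
def Bisimulation (R : L.Proc → M.Proc → Prop) : Prop :=
  ∀ P Q, R P Q →
    (∀ P', L.Tau P P' →
      (∃ Q', M.Taus Q Q' ∧ R P Q' ∧ R P' Q') ∨
      (∃ Q'' Q', M.Taus Q Q'' ∧ R P Q'' ∧ M.Tau Q'' Q' ∧ R P' Q')) ∧
    (∀ Q', M.Tau Q Q' →
      (∃ P', L.Taus P P' ∧ R P' Q ∧ R P' Q') ∨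
      (∃ P'' P', L.Taus P P'' ∧ R P'' Q ∧ L.Tau P'' P' ∧ R P' Q'))

/-- Equipollent, extensional, codivergent and bisimilar. -/
def Observational (R : L.Proc → M.Proc → Prop) : Prop :=
  Equipollent R ∧ Extensional R ∧ Codivergent R ∧ Bisimulation R

/-- Absolute equality of a calculus: the largest relation on its processes that is reflexive,
equipollent, extensional, codivergent and bisimilar, given as the union of all of them;
`AbsEq.isLargest` shows that the union has these properties itself. -/
def AbsEq (M : Calculus) (P Q : M.Proc) : Prop :=
  ∃ R : M.Proc → M.Proc → Prop, (∀ P, R P P) ∧ Observational R ∧ R P Q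

/-- `R` is a subbisimilarity from `L` to `M`. -/
structure IsSubbisimilarity (R : L.Proc → M.Proc → Prop) : Prop where
  total : ∀ P, ∃ Q, R P Q
  sound : ∀ P₁ P₂ Q₁ Q₂, R P₁ Q₁ → L.AbsEq P₁ P₂ → R P₂ Q₂ → M.AbsEq Q₁ Q₂
  observational : Observational R

/-- `L ⊑ M`. -/
def Subbisimilar (L M : Calculus) : Prop :=
  ∃ R : L.Proc → M.Proc → Prop, IsSubbisimilarity R

/-! ### The largest relation exists -/

/-- Bisimulations lift from one internal step to many. -/
theorem Bisimulation.taus {L M : Calculus} {R : L.Proc → M.Proc → Prop} (h : Bisimulation R)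
    {P P' : L.Proc} {Q : M.Proc} (hR : R P Q) (hP : L.Taus P P') :
    ∃ Q', M.Taus Q Q' ∧ R P' Q' := by
  induction hP with
  | refl => exact ⟨Q, .refl, hR⟩
  | tail _ hs ih =>
    obtain ⟨Q₁, h₁, r₁⟩ := ih
    rcases (h _ _ r₁).1 _ hs with ⟨Q', h', _, r'⟩ | ⟨Q'', Q', h', _, h'', r'⟩
    · exact ⟨Q', h₁.trans h', r'⟩
    · exact ⟨Q', (h₁.trans h').tail h'', r'⟩

theorem Observational.symm {L M : Calculus} {R : L.Proc → M.Proc → Prop}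
    (h : Observational R) : Observational fun Q P => R P Q :=
  ⟨fun P Q r => (h.1 Q P r).symm,
    ⟨fun P Q P' Q' r r' => h.2.1.1 Q P Q' P' r r', fun c P Q r => h.2.1.2 c Q P r⟩,
    fun P Q r => (h.2.2.1 Q P r).symm,
    fun P Q r => (h.2.2.2 Q P r).symm⟩

/-- Concatenate infinitely many nonempty finite internal action sequences. -/
theorem exists_infSeq {M : Calculus} (g : ℕ → M.Proc)
    (hg : ∀ j, M.TausPos (g j) (g (j + 1))) :
    ∃ f, M.InfSeq (g 0) f ∧ ∀ k, ∃ j, M.Taus (f k) (g (j + 1)) := by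
  have key : ∀ P : {P : M.Proc // ∃ j, M.TausPos P (g (j + 1))},
      ∃ P' : {P : M.Proc // ∃ j, M.TausPos P (g (j + 1))}, M.Tau P.1 P'.1 := by
    rintro ⟨P, j, hP⟩
    obtain ⟨P', h₁, h₂⟩ := (Relation.TransGen.head'_iff).1 hP
    exact ⟨⟨P', j + 1, Relation.TransGen.trans_right h₂ (hg (j + 1))⟩, h₁⟩
  choose next hnext using key
  let f : ℕ → {P : M.Proc // ∃ j, M.TausPos P (g (j + 1))} :=
    fun k => next^[k] ⟨g 0, 0, hg 0⟩
  refine ⟨fun k => (f k).1, ⟨rfl, fun i => ?_⟩, fun k => ?_⟩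
  · have : f (i + 1) = next (f i) := Function.iterate_succ_apply' next i _
    change M.Tau (f i).1 (f (i + 1)).1
    rw [this]
    exact hnext _
  · obtain ⟨j, hj⟩ := (f k).2
    exact ⟨j, hj.to_reflTransGen⟩

/-- Half of the composition of codivergent bisimulations. -/
theorem codivergent_comp_aux {L M N : Calculus} {R : L.Proc → M.Proc → Prop}
    {S : M.Proc → N.Proc → Prop} (hR : Codivergent R) (hR' : Bisimulation R)
    (hS : Codivergent S) {P : L.Proc} {Q : M.Proc} {O : N.Proc}
    (r : R P Q) (s : S Q O) (f : ℕ → N.Proc) (hf : N.InfSeq O f) :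
    ∃ k ≥ 1, ∃ P', L.TausPos P P' ∧ ∃ Q', R P' Q' ∧ S Q' (f k) := by
  have key : ∀ X : {X : M.Proc × ℕ // S X.1 (f X.2)}, ∃ Y : {X : M.Proc × ℕ // S X.1 (f X.2)},
      M.TausPos X.1.1 Y.1.1 ∧ 1 ≤ Y.1.2 := by
    rintro ⟨⟨Q, n⟩, hs⟩
    obtain ⟨k, hk, Q', h₁, h₂⟩ := (hS _ _ hs).1 (fun i => f (n + i)) ⟨rfl, fun i => hf.2 (n + i)⟩
    exact ⟨⟨(Q', n + k), h₂⟩, h₁, by simp only; omega⟩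
  choose next hnext using key
  have h0 : S Q (f 0) := by rw [hf.1]; exact s
  let g : ℕ → {X : M.Proc × ℕ // S X.1 (f X.2)} := fun j => next^[j] ⟨(Q, 0), h0⟩
  have hg : ∀ j, g (j + 1) = next (g j) := fun j => Function.iterate_succ_apply' next j _
  obtain ⟨e, he, he'⟩ := exists_infSeq (fun j => (g j).1.1) fun j => by
    rw [hg]; exact (hnext _).1
  obtain ⟨k, _, P', hP, hr⟩ := (hR _ _ r).1 e he
  obtain ⟨j, hj⟩ := he' k
  obtain ⟨P'', hP'', r'⟩ := Bisimulation.taus (R := fun Q P => R P Q)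
    (fun Q P r => (hR' P Q r).symm) hr hj
  refine ⟨(g (j + 1)).1.2, ?_, P'', Relation.TransGen.trans_left hP hP'', _, r', (g (j + 1)).2⟩
  rw [hg]
  exact (hnext _).2

/-- Half of the composition of bisimulations. -/
theorem bisimulation_comp_aux {L M N : Calculus} {R : L.Proc → M.Proc → Prop}
    {S : M.Proc → N.Proc → Prop} (hR : Bisimulation R) (hS : Bisimulation S)
    {P P' : L.Proc} {Q : M.Proc} {O : N.Proc} (r : R P Q) (s : S Q O) (hP : L.Tau P P') :
    (∃ O', N.Taus O O' ∧ (∃ X, R P X ∧ S X O') ∧ ∃ X, R P' X ∧ S X O') ∨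
    (∃ O'' O', N.Taus O O'' ∧ (∃ X, R P X ∧ S X O'') ∧ N.Tau O'' O' ∧
      ∃ X, R P' X ∧ S X O') := by
  rcases (hR _ _ r).1 _ hP with ⟨Q', h, r₁, r₂⟩ | ⟨Q'', Q', h, r₁, h', r₂⟩
  · obtain ⟨O', hO, s'⟩ := hS.taus s h
    exact .inl ⟨O', hO, ⟨_, r₁, s'⟩, _, r₂, s'⟩
  · obtain ⟨O₁, hO, s'⟩ := hS.taus s h
    rcases (hS _ _ s').1 _ h' with ⟨O', h₁, s₁, s₂⟩ | ⟨O'', O', h₁, s₁, h₂, s₂⟩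
    · exact .inl ⟨O', hO.trans h₁, ⟨_, r₁, s₁⟩, _, r₂, s₂⟩
    · exact .inr ⟨O'', O', hO.trans h₁, ⟨_, r₁, s₁⟩, h₂, _, r₂, s₂⟩

theorem Observational.comp {L M N : Calculus} {R : L.Proc → M.Proc → Prop}
    {S : M.Proc → N.Proc → Prop} (hR : Observational R) (hS : Observational S) :
    Observational fun P O => ∃ Q, R P Q ∧ S Q O := by
  have hR' := hR.symm
  have hS' := hS.symm
  refine ⟨?_, ⟨?_, ?_⟩, ?_, ?_⟩
  · rintro P O ⟨Q, r, s⟩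
    exact (hR.1 _ _ r).trans (hS.1 _ _ s)
  · rintro P O P' O' ⟨Q, r, s⟩ ⟨Q', r', s'⟩
    exact ⟨_, hR.2.1.1 _ _ _ _ r r', hS.2.1.1 _ _ _ _ s s'⟩
  · rintro c P O ⟨Q, r, s⟩
    exact ⟨_, hR.2.1.2 c _ _ r, hS.2.1.2 c _ _ s⟩
  · rintro P O ⟨Q, r, s⟩
    refine ⟨codivergent_comp_aux hR.2.2.1 hR.2.2.2 hS.2.2.1 r s, fun f hf => ?_⟩
    obtain ⟨k, hk, O', h, X, h₁, h₂⟩ :=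
      codivergent_comp_aux hS'.2.2.1 hS'.2.2.2 hR'.2.2.1 s r f hf
    exact ⟨k, hk, O', h, X, h₂, h₁⟩
  · rintro P O ⟨Q, r, s⟩
    refine ⟨fun P' hP => bisimulation_comp_aux hR.2.2.2 hS.2.2.2 r s hP, fun O' hO => ?_⟩
    rcases bisimulation_comp_aux hS'.2.2.2 hR'.2.2.2 s r hO with
      ⟨P', h, ⟨X, x₁, x₂⟩, Y, y₁, y₂⟩ | ⟨P'', P', h, ⟨X, x₁, x₂⟩, h', Y, y₁, y₂⟩
    · exact .inl ⟨P', h, ⟨X, x₂, x₁⟩, Y, y₂, y₁⟩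
    · exact .inr ⟨P'', P', h, ⟨X, x₂, x₁⟩, h', Y, y₂, y₁⟩

theorem observational_eq (M : Calculus) : Observational (L := M) (M := M) Eq := by
  refine ⟨?_, ⟨?_, ?_⟩, ?_, ?_⟩
  · rintro P _ rfl
    rfl
  · rintro P _ P' _ rfl rfl
    rfl
  · rintro c P _ rfl
    rfl
  · rintro P _ rfl
    refine ⟨fun f hf => ⟨1, le_rfl, f 1, ?_, rfl⟩, fun f hf => ⟨1, le_rfl, f 1, ?_, rfl⟩⟩ <;>
    · have := hf.2 0
      rw [hf.1] at this
      exact .single this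
  · rintro P _ rfl
    exact ⟨fun P' h => .inr ⟨P, P', .refl, rfl, h, rfl⟩,
      fun P' h => .inr ⟨P, P', .refl, rfl, h, rfl⟩⟩

/-- Absolute equality is the largest reflexive, equipollent, extensional, codivergent and
bisimilar relation. -/
theorem AbsEq.isLargest (M : Calculus) :
    ((∀ P, M.AbsEq P P) ∧ Observational M.AbsEq) ∧
      ∀ R : M.Proc → M.Proc → Prop, (∀ P, R P P) → Observational R →
        ∀ P Q, R P Q → M.AbsEq P Q := by
  refine ⟨⟨fun P => ⟨Eq, fun _ => rfl, observational_eq M, rfl⟩, ?_, ⟨?_, ?_⟩, ?_, ?_⟩,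
    fun R h h' P Q r => ⟨R, h, h', r⟩⟩
  · rintro P Q ⟨R, _, h, r⟩
    exact h.1 P Q r
  · rintro P Q P' Q' ⟨R, hr, h, r⟩ ⟨S, hs, h', s⟩
    exact ⟨_, fun P => ⟨P, hr P, hs P⟩, h.comp h', _,
      h.2.1.1 _ _ _ _ r (hr P'), h'.2.1.1 _ _ _ _ (hs Q) s⟩
  · rintro c P Q ⟨R, hr, h, r⟩
    exact ⟨R, hr, h, h.2.1.2 c _ _ r⟩
  · rintro P Q ⟨R, hr, h, r⟩
    have := h.2.2.1 P Q r
    refine ⟨fun f hf => ?_, fun f hf => ?_⟩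
    · obtain ⟨k, hk, X, h₁, h₂⟩ := this.1 f hf
      exact ⟨k, hk, X, h₁, R, hr, h, h₂⟩
    · obtain ⟨k, hk, X, h₁, h₂⟩ := this.2 f hf
      exact ⟨k, hk, X, h₁, R, hr, h, h₂⟩
  · rintro P Q ⟨R, hr, h, r⟩
    have := h.2.2.2 P Q r
    refine ⟨fun P' hP => ?_, fun Q' hQ => ?_⟩
    · rcases this.1 P' hP with ⟨X, h₁, h₂, h₃⟩ | ⟨X, Y, h₁, h₂, h₃, h₄⟩
      · exact .inl ⟨X, h₁, ⟨R, hr, h, h₂⟩, R, hr, h, h₃⟩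
      · exact .inr ⟨X, Y, h₁, ⟨R, hr, h, h₂⟩, h₃, R, hr, h, h₄⟩
    · rcases this.2 Q' hQ with ⟨X, h₁, h₂, h₃⟩ | ⟨X, Y, h₁, h₂, h₃, h₄⟩
      · exact .inl ⟨X, h₁, ⟨R, hr, h, h₂⟩, R, hr, h, h₃⟩
      · exact .inr ⟨X, Y, h₁, ⟨R, hr, h, h₂⟩, h₃, R, hr, h, h₄⟩

end Calculus

/-! ## The two calculi -/

/-- The calculus of the processes over a language of guards. -/
def calculus (G : GuardLang) : Calculus where
  Proc := Proc G
  Step := Step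
  par := Term.par
  nu := Proc.nu

/-- Match `[p = q]` and mismatch `[p ≠ q]`. -/
inductive MatchGuard (k v : ℕ) : Type where
  | eq (p q : Ref k v) : MatchGuard k v
  | ne (p q : Ref k v) : MatchGuard k v

namespace MatchGuard

def map {k v k' v' : ℕ} (ρ : Ref k v → Ref k' v') : MatchGuard k v → MatchGuard k' v'
  | eq p q => eq (ρ p) (ρ q)
  | ne p q => ne (ρ p) (ρ q)

def gn {k v : ℕ} : MatchGuard k v → Finset Name
  | eq p q => p.gn ∪ q.gn
  | ne p q => p.gn ∪ q.gn

/-- Truth of a closed guard; a closed reference is a global name. -/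
def Holds : MatchGuard 0 0 → Prop
  | eq p q => p = q
  | ne p q => p ≠ q

end MatchGuard

/-- Boolean expressions built from equalities of names by conjunction and negation. -/
inductive BoolExpr (k v : ℕ) : Type where
  | eq (p q : Ref k v) : BoolExpr k v
  | and (φ ψ : BoolExpr k v) : BoolExpr k v
  | not (φ : BoolExpr k v) : BoolExpr k v

namespace BoolExpr

def map {k v k' v' : ℕ} (ρ : Ref k v → Ref k' v') : BoolExpr k v → BoolExpr k' v'
  | eq p q => eq (ρ p) (ρ q)
  | and φ ψ => and (φ.map ρ) (ψ.map ρ)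
  | not φ => not (φ.map ρ)

def gn {k v : ℕ} : BoolExpr k v → Finset Name
  | eq p q => p.gn ∪ q.gn
  | and φ ψ => φ.gn ∪ ψ.gn
  | not φ => φ.gn

/-- Truth of a closed expression; a closed reference is a global name. -/
def Holds : BoolExpr 0 0 → Prop
  | eq p q => p = q
  | and φ ψ => φ.Holds ∧ ψ.Holds
  | not φ => ¬ φ.Holds

end BoolExpr

/-- The guards of `π`. -/
def matchLang : GuardLang where
  Guard := MatchGuard
  map := MatchGuard.map
  gn := MatchGuard.gn
  Holds := MatchGuard.Holds

/-- The guards of `π^∨`. -/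
def boolLang : GuardLang where
  Guard := BoolExpr
  map := BoolExpr.map
  gn := BoolExpr.gn
  Holds := BoolExpr.Holds

/-- The `π`-calculus, with the guards `[p = q]` and `[p ≠ q]`. -/
def pi : Calculus := calculus matchLang

/-- The calculus `π^∨`, with the guards `[φ]` for arbitrary Boolean expressions `φ`. -/
def piVee : Calculus := calculus boolLang

end PiCalc

/-! Both directions are witnessed by one relation, `Rel`, defined for processes over any two guard
languages. It is a congruence that also discards satisfied guards and parallel components without
transitions, and relates any two processes without transitions. Input continuations are related only
through their closed instances, because a guard acquires a truth value only once the received name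
is known.

`Rel.step` shows that `Rel` is a strong labelled simulation, and its generators are symmetric. Hence
each τ is answered by exactly one τ, which gives bisimulation, codivergence and equipollence
(`Rel.observational`); extensionality is built in. Soundness is then formal: if R is also total and
onto, R⁻¹ ; =_L ; R is a reflexive observational relation, so it lies inside the absolute equality
of the target.

It remains to translate terms both ways. A match or mismatch is already a Boolean expression.
Conversely, `branch φ S T` encodes "if φ then S else T": an equality becomes [p=q]S | [p≠q]T, a
negation swaps the branches, and a conjunction nests them. Closing the term leaves exactly one
branch alive, since every other one sits behind a false guard; the parallel composition thus never
creates an interaction.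

The remaining work is α-conversion: transitions commute with permutations of names, so bound and
local names can be chosen fresh. -/

namespace PiCalc

/-! ### Maps of references -/

namespace Ref

/-- Rename the global names of a reference. -/
def rename {k v : ℕ} (σ : Equiv.Perm Name) : Ref k v → Ref k v
  | glob a => glob (σ a)
  | loc i => loc i
  | var x => var x

/-- Turn the outermost local name into the global name `c`. -/
def unbind (c : Name) : Ref 1 0 → Ref 0 0
  | glob a => glob a
  | loc _ => glob c
  | var x => var x

theorem liftLoc_id {k v : ℕ} : liftLoc (id : Ref k v → Ref k v) = id := by
  funext r
  rcases r with a | i | x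
  · rfl
  · refine Fin.cases rfl (fun j => rfl) i
  · rfl

theorem liftVar_id {k v : ℕ} : liftVar (id : Ref k v → Ref k v) = id := by
  funext r
  rcases r with a | i | x
  · rfl
  · rfl
  · refine Fin.cases rfl (fun j => rfl) x

theorem liftLoc_wkLoc {k v k' v' : ℕ} (ρ : Ref k v → Ref k' v') (r : Ref k v) :
    liftLoc ρ r.wkLoc = (ρ r).wkLoc := by
  cases r <;> rfl

theorem liftVar_wkVar {k v k' v' : ℕ} (ρ : Ref k v → Ref k' v') (r : Ref k v) :
    liftVar ρ r.wkVar = (ρ r).wkVar := by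
  cases r <;> rfl

theorem liftLoc_comp {k v k' v' k'' v'' : ℕ} (ρ' : Ref k' v' → Ref k'' v'')
    (ρ : Ref k v → Ref k' v') : liftLoc (ρ' ∘ ρ) = liftLoc ρ' ∘ liftLoc ρ := by
  funext r
  rcases r with a | i | x
  · exact (liftLoc_wkLoc ρ' (ρ (glob a))).symm
  · refine Fin.cases rfl (fun j => ?_) i
    exact (liftLoc_wkLoc ρ' (ρ (loc j))).symm
  · exact (liftLoc_wkLoc ρ' (ρ (var x))).symm

theorem liftVar_comp {k v k' v' k'' v'' : ℕ} (ρ' : Ref k' v' → Ref k'' v'')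
    (ρ : Ref k v → Ref k' v') : liftVar (ρ' ∘ ρ) = liftVar ρ' ∘ liftVar ρ := by
  funext r
  rcases r with a | i | x
  · exact (liftVar_wkVar ρ' (ρ (glob a))).symm
  · exact (liftVar_wkVar ρ' (ρ (loc i))).symm
  · refine Fin.cases rfl (fun j => ?_) x
    exact (liftVar_wkVar ρ' (ρ (var j))).symm

theorem liftLoc_rename {k v : ℕ} (σ : Equiv.Perm Name) :
    liftLoc (rename σ : Ref k v → Ref k v) = rename σ := by
  funext r
  rcases r with a | i | x
  · rfl
  · refine Fin.cases rfl (fun j => rfl) i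
  · rfl

theorem liftVar_rename {k v : ℕ} (σ : Equiv.Perm Name) :
    liftVar (rename σ : Ref k v → Ref k v) = rename σ := by
  funext r
  rcases r with a | i | x
  · rfl
  · rfl
  · refine Fin.cases rfl (fun j => rfl) x

theorem rename_comp_bind (σ : Equiv.Perm Name) (c : Name) :
    rename σ ∘ bind c = bind (σ c) ∘ rename σ := by
  funext r
  rcases r with a | i | x
  · by_cases h : a = c <;> simp [bind, rename, h]
  · rfl
  · rfl

theorem rename_comp_subst (σ : Equiv.Perm Name) (c : Name) :
    rename σ ∘ subst c = subst (σ c) ∘ rename σ := by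
  funext r
  cases r <;> rfl

theorem unbind_comp_bind (c : Name) : unbind c ∘ bind c = id := by
  funext r
  rcases r with a | i | x
  · by_cases h : a = c <;> simp [bind, unbind, h]
  · exact i.elim0
  · rfl

theorem rename_comp_rename {k v : ℕ} (σ τ : Equiv.Perm Name) :
    (rename σ ∘ rename τ : Ref k v → Ref k v) = rename (σ * τ) := by
  funext r
  cases r <;> rfl

theorem rename_injective {k v : ℕ} (σ : Equiv.Perm Name) :
    Function.Injective (rename σ : Ref k v → Ref k v) := by
  intro r s h
  cases r <;> cases s <;> simp_all [rename]

/-- `ρ` sends local names and name variables to such. -/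
def Pure {k v k' v' : ℕ} (ρ : Ref k v → Ref k' v') : Prop :=
  ∀ r, r.gn = ∅ → (ρ r).gn = ∅

theorem gn_wkLoc {k v : ℕ} (r : Ref k v) : r.wkLoc.gn = r.gn := by cases r <;> rfl

theorem gn_wkVar {k v : ℕ} (r : Ref k v) : r.wkVar.gn = r.gn := by cases r <;> rfl

theorem Pure.liftLoc {k v k' v' : ℕ} {ρ : Ref k v → Ref k' v'} (h : Pure ρ) :
    Pure (Ref.liftLoc ρ) := by
  intro r hr
  rcases r with a | i | x
  · simp [gn] at hr
  · refine Fin.cases rfl (fun j => ?_) i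
    exact (gn_wkLoc _).trans (h _ rfl)
  · exact (gn_wkLoc _).trans (h _ rfl)

theorem Pure.liftVar {k v k' v' : ℕ} {ρ : Ref k v → Ref k' v'} (h : Pure ρ) :
    Pure (Ref.liftVar ρ) := by
  intro r hr
  rcases r with a | i | x
  · simp [gn] at hr
  · exact (gn_wkVar _).trans (h _ rfl)
  · refine Fin.cases rfl (fun j => ?_) x
    exact (gn_wkVar _).trans (h _ rfl)

theorem pure_rename {k v : ℕ} (σ : Equiv.Perm Name) : Pure (rename σ : Ref k v → Ref k v) := by
  intro r hr
  cases r <;> simp_all [gn, rename]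

theorem pure_bind (c : Name) : Pure (bind c) := by
  intro r hr
  cases r <;> simp_all [gn, bind]

/-- Purity rules out maps such as `subst c`, which create a global name where there was none;
renamings and `bind c` are pure. -/
theorem gn_apply {k v k' v' : ℕ} {ρ : Ref k v → Ref k' v'} (h : Pure ρ) (r : Ref k v) :
    (ρ r).gn = r.gn.biUnion fun a => (ρ (glob a)).gn := by
  rcases r with a | i | x
  · simp [gn]
  · simpa [gn] using h (loc i) rfl
  · simpa [gn] using h (var x) rfl

end Ref

/-! ### Laws of the two guard languages -/

/-- The laws of a language of guards. -/
structure GuardLang.Lawful (G : GuardLang) : Prop where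
  map_map : ∀ {k v k' v' k'' v'' : ℕ} (ρ' : Ref k' v' → Ref k'' v'') (ρ : Ref k v → Ref k' v')
    (g : G.Guard k v), G.map ρ' (G.map ρ g) = G.map (ρ' ∘ ρ) g
  map_id : ∀ {k v : ℕ} (g : G.Guard k v), G.map id g = g
  map_congr : ∀ {k v k' v' : ℕ} {ρ ρ' : Ref k v → Ref k' v'} (g : G.Guard k v),
    (∀ r, r.gn ⊆ G.gn g → ρ r = ρ' r) → G.map ρ g = G.map ρ' g
  gn_map : ∀ {k v k' v' : ℕ} {ρ : Ref k v → Ref k' v'} (_ : Ref.Pure ρ) (g : G.Guard k v),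
    G.gn (G.map ρ g) = (G.gn g).biUnion fun a => (ρ (.glob a)).gn
  holds_rename : ∀ (σ : Equiv.Perm Name) (g : G.Guard 0 0),
    G.Holds (G.map (Ref.rename σ) g) ↔ G.Holds g

theorem matchLang_lawful : matchLang.Lawful where
  map_map ρ' ρ g := by cases g <;> rfl
  map_id g := by cases g <;> rfl
  map_congr g h := by
    cases g <;>
    · simp only [matchLang, MatchGuard.map, MatchGuard.gn] at h ⊢
      rw [h _ Finset.subset_union_left, h _ Finset.subset_union_right]
  gn_map h g := by
    cases g <;>
    · simp only [matchLang, MatchGuard.map, MatchGuard.gn, Finset.union_biUnion]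
      rw [← Ref.gn_apply h, ← Ref.gn_apply h]
  holds_rename σ g := by
    cases g <;> simp [matchLang, MatchGuard.map, MatchGuard.Holds, (Ref.rename_injective σ).eq_iff]

theorem boolLang_lawful : boolLang.Lawful where
  map_map ρ' ρ g := by
    simp only [boolLang]
    induction g <;> simp_all [BoolExpr.map]
  map_id g := by
    simp only [boolLang]
    induction g <;> simp_all [BoolExpr.map]
  map_congr g h := by
    simp only [boolLang] at h ⊢
    induction g with
    | eq p q =>
      simp only [BoolExpr.map, BoolExpr.gn] at h ⊢
      rw [h _ Finset.subset_union_left, h _ Finset.subset_union_right]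
    | and φ ψ ih₁ ih₂ =>
      simp only [BoolExpr.map]
      rw [ih₁ fun r hr => h r (hr.trans Finset.subset_union_left),
        ih₂ fun r hr => h r (hr.trans Finset.subset_union_right)]
    | not φ ih => simp only [BoolExpr.map]; rw [ih h]
  gn_map h g := by
    simp only [boolLang]
    induction g with
    | eq p q =>
      simp only [BoolExpr.map, BoolExpr.gn, Finset.union_biUnion]
      rw [← Ref.gn_apply h, ← Ref.gn_apply h]
    | and φ ψ ih₁ ih₂ => simp only [BoolExpr.map, BoolExpr.gn, Finset.union_biUnion, ih₁, ih₂]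
    | not φ ih => exact ih
  holds_rename σ g := by
    simp only [boolLang]
    induction g <;>
      simp_all [BoolExpr.map, BoolExpr.Holds, (Ref.rename_injective σ).eq_iff]

/-! ### Maps and renamings of terms -/

namespace Term

variable {G : GuardLang}

theorem map_map (hG : G.Lawful) {k v k' v' k'' v'' : ℕ} (ρ' : Ref k' v' → Ref k'' v'')
    (ρ : Ref k v → Ref k' v') (T : Term G k v) : (T.map ρ).map ρ' = T.map (ρ' ∘ ρ) := by
  induction T generalizing k' v' k'' v'' <;>
    simp_all [map, hG.map_map, Ref.liftLoc_comp, Ref.liftVar_comp]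

theorem map_id (hG : G.Lawful) {k v : ℕ} (T : Term G k v) : T.map id = T := by
  induction T <;> simp_all [map, hG.map_id, Ref.liftLoc_id, Ref.liftVar_id]

theorem liftLoc_congr {k v k' v' : ℕ} {ρ ρ' : Ref k v → Ref k' v'} {s : Finset Name}
    (h : ∀ r, r.gn ⊆ s → ρ r = ρ' r) (r : Ref (k + 1) v) (hr : r.gn ⊆ s) :
    Ref.liftLoc ρ r = Ref.liftLoc ρ' r := by
  rcases r with a | i | x
  · exact congrArg Ref.wkLoc (h _ hr)
  · refine Fin.cases rfl (fun j => ?_) i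
    exact congrArg Ref.wkLoc (h _ (Finset.empty_subset _))
  · exact congrArg Ref.wkLoc (h _ hr)

theorem liftVar_congr {k v k' v' : ℕ} {ρ ρ' : Ref k v → Ref k' v'} {s : Finset Name}
    (h : ∀ r, r.gn ⊆ s → ρ r = ρ' r) (r : Ref k (v + 1)) (hr : r.gn ⊆ s) :
    Ref.liftVar ρ r = Ref.liftVar ρ' r := by
  rcases r with a | i | x
  · exact congrArg Ref.wkVar (h _ hr)
  · exact congrArg Ref.wkVar (h _ hr)
  · refine Fin.cases rfl (fun j => ?_) x
    exact congrArg Ref.wkVar (h _ (Finset.empty_subset _))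

/-- Local names and variables have no global names, so agreement is required on all of them, and on
just those global names that occur in the term. This is what makes renaming of absent names
harmless. -/
theorem map_congr (hG : G.Lawful) {k v k' v' : ℕ} {ρ ρ' : Ref k v → Ref k' v'} (T : Term G k v)
    (h : ∀ r, r.gn ⊆ T.gn → ρ r = ρ' r) : T.map ρ = T.map ρ' := by
  induction T generalizing k' v' with
  | nil => rfl
  | inSum r n T ih =>
    simp only [map, gn] at h ⊢
    rw [h n Finset.subset_union_left]
    congr 1
    funext i
    refine ih i fun r hr => liftVar_congr h r (hr.trans ?_)
    exact (Finset.subset_biUnion_of_mem (fun i => (T i).gn) (Finset.mem_univ i)).trans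
      Finset.subset_union_right
  | outSum r n m T ih =>
    simp only [map, gn, Finset.union_assoc] at h ⊢
    rw [h n Finset.subset_union_left]
    congr 1
    · funext i
      refine h _ (Finset.Subset.trans ?_ Finset.subset_union_right)
      exact (Finset.subset_biUnion_of_mem (fun i => (m i).gn) (Finset.mem_univ i)).trans
        Finset.subset_union_left
    · funext i
      refine ih i fun r hr => h r (hr.trans (Finset.Subset.trans ?_ Finset.subset_union_right))
      exact (Finset.subset_biUnion_of_mem (fun i => (T i).gn) (Finset.mem_univ i)).trans
        Finset.subset_union_right
  | par S T ih₁ ih₂ =>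
    simp only [map]
    rw [ih₁ fun r hr => h r (hr.trans Finset.subset_union_left),
      ih₂ fun r hr => h r (hr.trans Finset.subset_union_right)]
  | res T ih =>
    simp only [map]
    rw [ih (liftLoc_congr h)]
  | guard g T ih =>
    simp only [map]
    rw [hG.map_congr g fun r hr => h r (hr.trans Finset.subset_union_left),
      ih fun r hr => h r (hr.trans Finset.subset_union_right)]
  | repIn n T ih =>
    simp only [map]
    rw [h n Finset.subset_union_left,
      ih fun r hr => liftVar_congr h r (hr.trans Finset.subset_union_right)]
  | repOut n m T ih =>
    simp only [map]
    simp only [gn, Finset.union_assoc] at h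
    rw [h n Finset.subset_union_left,
      h m (Finset.subset_union_left.trans Finset.subset_union_right),
      ih fun r hr => h r (hr.trans (Finset.subset_union_right.trans Finset.subset_union_right))]

theorem gn_map (hG : G.Lawful) {k v k' v' : ℕ} {ρ : Ref k v → Ref k' v'} (h : Ref.Pure ρ)
    (T : Term G k v) : (T.map ρ).gn = T.gn.biUnion fun a => (ρ (.glob a)).gn := by
  induction T generalizing k' v' with
  | nil => rfl
  | inSum r n T ih =>
    simp only [map, gn, Finset.union_biUnion, ih _ h.liftVar, Ref.gn_apply h n]
    rw [Finset.biUnion_biUnion]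
    simp only [Ref.liftVar, Ref.gn_wkVar]
  | outSum r n m T ih =>
    simp only [map, gn, Finset.union_biUnion, ih _ h, Ref.gn_apply h n]
    rw [Finset.biUnion_biUnion, Finset.biUnion_biUnion]
    simp only [Ref.gn_apply h (m _)]
  | par S T ih₁ ih₂ => simp only [map, gn, Finset.union_biUnion, ih₁ h, ih₂ h]
  | res T ih => simp only [map, gn, ih h.liftLoc, Ref.liftLoc, Ref.gn_wkLoc]
  | guard g T ih => simp only [map, gn, Finset.union_biUnion, ih h, hG.gn_map h]
  | repIn n T ih =>
    simp only [map, gn, Finset.union_biUnion, ih h.liftVar, Ref.gn_apply h n, Ref.liftVar,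
      Ref.gn_wkVar]
  | repOut n m T ih =>
    simp only [map, gn, Finset.union_biUnion, ih h, Ref.gn_apply h n, Ref.gn_apply h m]

/-- Rename the global names of a term. -/
def rename {k v : ℕ} (σ : Equiv.Perm Name) (T : Term G k v) : Term G k v := T.map (Ref.rename σ)

theorem mem_gn_rename (hG : G.Lawful) {k v : ℕ} (σ : Equiv.Perm Name) (T : Term G k v)
    (a : Name) : σ a ∈ (T.rename σ).gn ↔ a ∈ T.gn := by
  rw [rename, gn_map hG (Ref.pure_rename σ)]
  simp [Ref.rename, Ref.gn]

theorem rename_rename (hG : G.Lawful) {k v : ℕ} (σ τ : Equiv.Perm Name) (T : Term G k v) :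
    (T.rename τ).rename σ = T.rename (σ * τ) := by
  rw [rename, rename, map_map hG, Ref.rename_comp_rename, rename]

theorem rename_eq_self (hG : G.Lawful) {k v : ℕ} (σ : Equiv.Perm Name) (T : Term G k v)
    (h : ∀ a ∈ T.gn, σ a = a) : T.rename σ = T := by
  refine (map_congr hG T fun r hr => ?_).trans (map_id hG T)
  rcases r with a | i | x
  · exact congrArg Ref.glob (h a (hr (by simp [Ref.gn])))
  · rfl
  · rfl

theorem rename_swap_eq_self (hG : G.Lawful) {k v : ℕ} {c d : Name} (T : Term G k v)
    (hc : c ∉ T.gn) (hd : d ∉ T.gn) : T.rename (Equiv.swap c d) = T :=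
  rename_eq_self hG _ T fun _ ha =>
    Equiv.swap_apply_of_ne_of_ne (fun h => hc (h ▸ ha)) fun h => hd (h ▸ ha)

theorem rename_swap_swap (hG : G.Lawful) {k v : ℕ} (c d : Name) (T : Term G k v) :
    (T.rename (Equiv.swap c d)).rename (Equiv.swap c d) = T := by
  rw [rename_rename hG, Equiv.swap_mul_self]
  exact rename_eq_self hG _ T fun _ _ => rfl

theorem rename_subst (hG : G.Lawful) (σ : Equiv.Perm Name) (c : Name) (T : Term G 0 1) :
    Term.rename σ (T.map (Ref.subst c)) = (T.rename σ).map (Ref.subst (σ c)) := by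
  rw [rename, rename, map_map hG, map_map hG, Ref.rename_comp_subst]

end Term

/-! ### Localization and α-conversion -/

namespace Proc

variable {G : GuardLang}

theorem mem_gn_nu (hG : G.Lawful) (c : Name) (P : Proc G) (a : Name) :
    a ∈ (nu c P).gn ↔ a ∈ P.gn ∧ a ≠ c := by
  rw [nu, Term.gn, Term.gn_map hG (Ref.pure_bind c), Finset.mem_biUnion]
  constructor
  · rintro ⟨b, hb, h⟩
    by_cases hc : b = c
    · simp [Ref.bind, hc, Ref.gn] at h
    · simp only [Ref.bind, hc, if_false, Ref.gn, Finset.mem_singleton] at h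
      exact h ▸ ⟨hb, hc⟩
  · rintro ⟨ha, hc⟩
    exact ⟨a, ha, by simp [Ref.bind, hc, Ref.gn]⟩

theorem rename_nu (hG : G.Lawful) (σ : Equiv.Perm Name) (c : Name) (P : Proc G) :
    (nu c P).rename σ = nu (σ c) (P.rename σ) := by
  simp only [nu, Term.rename, Term.map, Ref.liftLoc_rename]
  rw [Term.map_map hG, Term.map_map hG, Ref.rename_comp_bind]

theorem nu_injective (hG : G.Lawful) {c : Name} {P Q : Proc G} (h : nu c P = nu c Q) :
    P = Q := by
  have h' : Term.map (Ref.bind c) P = Term.map (Ref.bind c) Q := by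
    injection h
  have := congrArg (Term.map (Ref.unbind c)) h'
  rwa [Term.map_map hG, Term.map_map hG, Ref.unbind_comp_bind, Term.map_id hG,
    Term.map_id hG] at this

/-- Renaming of the local name. -/
theorem nu_swap (hG : G.Lawful) {c d : Name} {P : Proc G} (h : d ∉ (nu c P).gn) :
    nu d (P.rename (Equiv.swap c d)) = nu c P := by
  have hc : c ∉ (nu c P).gn := by simp [mem_gn_nu hG]
  have := rename_nu hG (Equiv.swap c d) c P
  rwa [Term.rename_swap_eq_self hG _ hc h, Equiv.swap_apply_left, eq_comm] at this

/-- Opening the binder with a fresh name and closing it again changes nothing, so a de Bruijn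
localization is a named one for any fresh name. -/
theorem exists_eq_nu (hG : G.Lawful) {T : Term G 1 0} {c : Name} (h : c ∉ T.gn) :
    Term.res T = nu c (T.map (Ref.unbind c)) := by
  rw [nu, Term.map_map hG]
  congr 1
  refine (Term.map_id hG T).symm.trans (Term.map_congr hG T fun r hr => ?_)
  rcases r with a | i | x
  · have : a ≠ c := fun e => h (e ▸ hr (by simp [Ref.gn]))
    simp [Ref.unbind, Ref.bind, this]
  · simp [Ref.unbind, Ref.bind, Fin.eq_zero i]
  · rfl

end Proc

/-! ### Transitions: equivariance and inversion -/

namespace Action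

/-- Rename the names of an action. -/
def rename (σ : Equiv.Perm Name) : Action → Action
  | inp a b => inp (σ a) (σ b)
  | out a b => out (σ a) (σ b)
  | bout a c => bout (σ a) (σ c)
  | tau => tau

theorem mem_names_rename (σ : Equiv.Perm Name) (l : Action) (a : Name) :
    σ a ∈ (l.rename σ).names ↔ a ∈ l.names := by
  cases l <;> simp [rename, names]

theorem disjoint_bn_rename {σ : Equiv.Perm Name} {l : Action} {s t : Finset Name}
    (h : ∀ a, σ a ∈ t ↔ a ∈ s) : Disjoint (l.rename σ).bn t ↔ Disjoint l.bn s := by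
  cases l <;> simp [rename, bn, h]

theorem bn_subset_names (l : Action) : l.bn ⊆ l.names := by
  cases l <;> simp [bn, names]

theorem rename_swap_swap (c d : Name) (l : Action) :
    (l.rename (Equiv.swap c d)).rename (Equiv.swap c d) = l := by
  cases l <;> simp [rename]

theorem rename_swap_eq_self {c d : Name} {l : Action} (hc : c ∉ l.names) (hd : d ∉ l.names) :
    l.rename (Equiv.swap c d) = l := by
  cases l <;> simp_all [rename, names, Equiv.swap_apply_of_ne_of_ne, eq_comm]

end Action

variable {G G' : GuardLang}

theorem disjoint_bn_rename (hG : G.Lawful) {k v : ℕ} {σ : Equiv.Perm Name} {l : Action}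
    {T : Term G k v} :
    Disjoint (l.rename σ).bn (T.rename σ).gn ↔ Disjoint l.bn T.gn :=
  Action.disjoint_bn_rename (Term.mem_gn_rename hG σ T)

namespace Step

/-- A permutation preserves inequality of names, hence mismatches, truth of guards and all freshness
side conditions; a non-injective substitution would not. -/
theorem rename (hG : G.Lawful) (σ : Equiv.Perm Name) {P P' : Proc G} {l : Action}
    (h : Step P l P') : Step (P.rename σ) (l.rename σ) (P'.rename σ) := by
  induction h with
  | inp r a c T i =>
    rw [Term.rename_subst hG]
    have := Step.inp r (σ a) (σ c) (fun i => (T i).rename σ) i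
    simpa only [Term.rename, Term.map, Ref.liftVar_rename, Ref.rename, Action.rename] using this
  | out r a c T i => exact Step.out r (σ a) (fun i => σ (c i)) (fun i => (T i).rename σ) i
  | parR S T T' l _ h ih => exact Step.parR _ _ _ _ ih ((disjoint_bn_rename hG).2 h)
  | parL S T T' l _ h ih => exact Step.parL _ _ _ _ ih ((disjoint_bn_rename hG).2 h)
  | comL S S' T T' a b _ _ ih₁ ih₂ => exact Step.comL _ _ _ _ _ _ ih₁ ih₂
  | comR S S' T T' a b _ _ ih₁ ih₂ => exact Step.comR _ _ _ _ _ _ ih₁ ih₂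
  | closeL S S' T T' a c _ _ h ih₁ ih₂ =>
    rw [Proc.rename_nu hG]
    exact Step.closeL _ _ _ _ _ _ ih₁ ih₂ ((Term.mem_gn_rename hG σ S c).not.2 h)
  | closeR S S' T T' a c _ _ h ih₁ ih₂ =>
    rw [Proc.rename_nu hG]
    exact Step.closeR _ _ _ _ _ _ ih₁ ih₂ ((Term.mem_gn_rename hG σ T c).not.2 h)
  | opn T T' a c _ h ih =>
    rw [Proc.rename_nu hG]
    exact Step.opn _ _ _ _ ih (σ.injective.ne h)
  | res T T' c l _ h ih =>
    rw [Proc.rename_nu hG, Proc.rename_nu hG]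
    exact Step.res _ _ _ _ ih ((Action.mem_names_rename σ l c).not.2 h)
  | guard g T T' l hg _ h ih =>
    refine Step.guard _ _ _ _ ((hG.holds_rename σ g).2 hg) ih
      ((Action.disjoint_bn_rename fun a => ?_).2 h)
    rw [hG.gn_map (Ref.pure_rename σ)]
    simp [Ref.rename, Ref.gn]
  | repOut a b T => exact Step.repOut _ _ _
  | repIn a b T =>
    have := Step.repIn (σ a) (σ b) (T.rename σ)
    rw [← Term.rename_subst hG] at this
    simpa only [Term.rename, Term.map, Ref.liftVar_rename, Ref.rename, Action.rename] using this

/-- The side conditions of the rules accumulate to freshness of the bound name for the whole source,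
so swapping it with another fresh name fixes the source. -/
theorem disjoint_bn_gn (hG : G.Lawful) {P P' : Proc G} {l : Action} (h : Step P l P') :
    Disjoint l.bn P.gn := by
  induction h with
  | parR S T T' l _ h ih => exact Finset.disjoint_union_right.2 ⟨h, ih⟩
  | parL S T T' l _ h ih => exact Finset.disjoint_union_right.2 ⟨ih, h⟩
  | opn T T' a c _ h ih => simp [Action.bn, Proc.mem_gn_nu hG]
  | res T T' c l _ h ih =>
    exact ih.mono_right fun a ha => ((Proc.mem_gn_nu hG c T a).1 ha).1
  | guard g T T' l hg _ h ih => exact Finset.disjoint_union_right.2 ⟨h, ih⟩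
  | _ => simp [Action.bn]

theorem bout_ne {P P' : Proc G} {a c : Name} (h : Step P (.bout a c) P') : a ≠ c := by
  generalize hl : Action.bout a c = l at h
  induction h with
  | opn T T' a' c' _ h ih => cases hl; exact h
  | parR S T T' l _ h ih => exact ih hl
  | parL S T T' l _ h ih => exact ih hl
  | res T T' c l _ h ih => exact ih hl
  | guard g T T' l hg _ h ih => exact ih hl
  | _ => cases hl

/-- Change of the bound name of a bound output. -/
theorem bout_swap (hG : G.Lawful) {P P' : Proc G} {a c d : Name} (h : Step P (.bout a c) P')
    (hd : d ∉ P.gn) (ha : a ≠ d) :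
    Step P (.bout a d) (P'.rename (Equiv.swap c d)) := by
  have := h.rename hG (Equiv.swap c d)
  have hc : c ∉ P.gn := by simpa [Action.bn] using h.disjoint_bn_gn hG
  rwa [Term.rename_swap_eq_self hG _ hc hd, Action.rename, Equiv.swap_apply_left,
    Equiv.swap_apply_of_ne_of_ne h.bout_ne ha] at this

/-- Change of a received fresh name. -/
theorem inp_swap (hG : G.Lawful) {P P' : Proc G} {a c d : Name} (h : Step P (.inp a c) P')
    (hc : c ∉ P.gn) (hd : d ∉ P.gn) (hac : a ≠ c) (ha : a ≠ d) :
    Step P (.inp a d) (P'.rename (Equiv.swap c d)) := by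
  have := h.rename hG (Equiv.swap c d)
  rwa [Term.rename_swap_eq_self hG _ hc hd, Action.rename, Equiv.swap_apply_left,
    Equiv.swap_apply_of_ne_of_ne hac ha] at this

theorem inSum_inv {r : ℕ} {n : Ref 0 0} {T : Fin (r + 1) → Term G 0 1} {l : Action}
    {P' : Proc G} (h : Step (.inSum r n T) l P') :
    ∃ a c i, n = .glob a ∧ l = .inp a c ∧ P' = (T i).map (Ref.subst c) := by
  generalize hP : Term.inSum r n T = P at h
  cases h <;> cases hP
  exact ⟨_, _, _, rfl, rfl, rfl⟩

theorem outSum_inv {r : ℕ} {n : Ref 0 0} {m : Fin (r + 1) → Ref 0 0}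
    {T : Fin (r + 1) → Proc G} {l : Action} {P' : Proc G} (h : Step (.outSum r n m T) l P') :
    ∃ (a : Name) (c : Fin (r + 1) → Name) (i : Fin (r + 1)), n = .glob a ∧
      m = (fun j => .glob (c j)) ∧ l = .out a (c i) ∧ P' = T i := by
  generalize hP : Term.outSum r n m T = P at h
  cases h <;> cases hP
  exact ⟨_, _, _, rfl, rfl, rfl, rfl⟩

theorem repIn_inv {n : Ref 0 0} {T : Term G 0 1} {l : Action} {P' : Proc G}
    (h : Step (.repIn n T) l P') :
    ∃ a b, n = .glob a ∧ l = .inp a b ∧ P' = .par (T.map (Ref.subst b)) (.repIn n T) := by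
  generalize hP : Term.repIn n T = P at h
  cases h <;> cases hP
  exact ⟨_, _, rfl, rfl, rfl⟩

theorem repOut_inv {n m : Ref 0 0} {T : Proc G} {l : Action} {P' : Proc G}
    (h : Step (.repOut n m T) l P') :
    ∃ a b, n = .glob a ∧ m = .glob b ∧ l = .out a b ∧ P' = .par T (.repOut n m T) := by
  generalize hP : Term.repOut n m T = P at h
  cases h <;> cases hP
  exact ⟨_, _, rfl, rfl, rfl, rfl⟩

theorem guard_inv {g : G.Guard 0 0} {T P' : Proc G} {l : Action} (h : Step (.guard g T) l P') :
    G.Holds g ∧ Step T l P' := by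
  generalize hP : Term.guard g T = P at h
  cases h <;> cases hP
  exact ⟨‹_›, ‹_›⟩

theorem par_inv {S T P' : Proc G} {l : Action} (h : Step (.par S T) l P') :
    (∃ T', Step T l T' ∧ P' = .par S T') ∨ (∃ S', Step S l S' ∧ P' = .par S' T) ∨
    (l = .tau ∧ ∃ S' T' a b, P' = .par S' T' ∧
      (Step S (.inp a b) S' ∧ Step T (.out a b) T' ∨
        Step S (.out a b) S' ∧ Step T (.inp a b) T')) ∨
    (l = .tau ∧ ∃ S' T' a c, P' = Proc.nu c (.par S' T') ∧
      (Step S (.inp a c) S' ∧ Step T (.bout a c) T' ∧ c ∉ S.gn ∨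
        Step S (.bout a c) S' ∧ Step T (.inp a c) T' ∧ c ∉ T.gn)) := by
  generalize hP : Term.par S T = P at h
  cases h <;> cases hP
  · exact .inl ⟨_, ‹_›, rfl⟩
  · exact .inr (.inl ⟨_, ‹_›, rfl⟩)
  · exact .inr (.inr (.inl ⟨rfl, _, _, _, _, rfl, .inl ⟨‹_›, ‹_›⟩⟩))
  · exact .inr (.inr (.inl ⟨rfl, _, _, _, _, rfl, .inr ⟨‹_›, ‹_›⟩⟩))
  · exact .inr (.inr (.inr ⟨rfl, _, _, _, _, rfl, .inl ⟨‹_›, ‹_›, ‹_›⟩⟩))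
  · exact .inr (.inr (.inr ⟨rfl, _, _, _, _, rfl, .inr ⟨‹_›, ‹_›, ‹_›⟩⟩))

/-- The derivation may have used another representative of the localization, with local name d
instead of c. Injectivity of `nu d` identifies its body as P with c and d swapped. -/
theorem nu_inv (hG : G.Lawful) {c : Name} {P P' : Proc G} {l : Action}
    (h : Step (Proc.nu c P) l P') :
    (∃ a d, l = .bout a d ∧ a ≠ d ∧ d ∉ (Proc.nu c P).gn ∧
      Step (P.rename (Equiv.swap c d)) (.out a d) P') ∨
    (∃ d T', d ∉ (Proc.nu c P).gn ∧ d ∉ l.names ∧ Step (P.rename (Equiv.swap c d)) l T' ∧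
      P' = Proc.nu d T') := by
  generalize hP : Proc.nu c P = R at h
  have key : ∀ {d : Name} {T : Proc G}, Proc.nu c P = Proc.nu d T →
      d ∉ (Proc.nu d T).gn ∧ P.rename (Equiv.swap c d) = T := by
    intro d T e
    have hd : d ∉ (Proc.nu d T).gn := by simp [Proc.mem_gn_nu hG]
    exact ⟨hd, Proc.nu_injective hG ((Proc.nu_swap hG (e ▸ hd)).trans e)⟩
  cases h with
  | opn T _ a d h ha =>
    obtain ⟨hd, rfl⟩ := key hP
    exact .inl ⟨a, d, rfl, ha, hd, h⟩
  | res T T' d _ h hl =>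
    obtain ⟨hd, rfl⟩ := key hP
    exact .inr ⟨d, T', hd, hl, h, rfl⟩
  | _ => cases hP

/-- The local name of the process under a localization may be chosen fresh. -/
theorem nu_inv_fresh (hG : G.Lawful) {c : Name} {P P' : Proc G} {l : Action}
    (h : Step (Proc.nu c P) l P') (s : Finset Name) :
    (∃ a d, l = .bout a d ∧ a ≠ d ∧ d ∉ (Proc.nu c P).gn ∧
      Step (P.rename (Equiv.swap c d)) (.out a d) P') ∨
    (∃ d T', d ∉ s ∧ d ∉ l.names ∧ Step (P.rename (Equiv.swap c d)) l T' ∧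
      P' = Proc.nu d T') := by
  refine (nu_inv hG h).imp_right ?_
  rintro ⟨e, T', he, hl, h', rfl⟩
  obtain ⟨d, hd⟩ := Infinite.exists_notMem_finset
    (s ∪ l.names ∪ (Proc.nu c P).gn ∪ (Proc.nu e T').gn ∪ (P.rename (Equiv.swap c e)).gn)
  simp only [Finset.mem_union, not_or] at hd
  obtain ⟨⟨⟨⟨hs, hdl⟩, hdP⟩, hdT⟩, hde⟩ := hd
  refine ⟨d, T'.rename (Equiv.swap e d), hs, hdl, ?_, (Proc.nu_swap hG hdT).symm⟩
  have h₁ := h'.rename hG (Equiv.swap e d)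
  rw [Action.rename_swap_eq_self hl hdl] at h₁
  convert h₁ using 1
  -- The two bodies arise from different permutations, so they are compared after binding d, where
  -- both become `nu c P`.
  refine Proc.nu_injective hG (c := d) ?_
  have h₂ := Proc.nu_swap hG he
  rw [Proc.nu_swap hG hdP, Proc.nu_swap hG (by rwa [h₂]), h₂]

end Step

/-! ### Similarity up to satisfied guards and dead components -/

/-- A process without transitions. -/
def Dead (P : Proc G) : Prop := ∀ l P', ¬ Step P l P'

theorem Dead.rename (hG : G.Lawful) (σ : Equiv.Perm Name) {P : Proc G} (h : Dead P) :
    Dead (P.rename σ) := by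
  intro l P' hs
  have := hs.rename hG σ⁻¹
  rw [Term.rename_rename hG, inv_mul_cancel, Term.rename_eq_self hG _ _ fun _ _ => rfl] at this
  exact h _ _ this

theorem dead_nil : Dead (Term.nil : Proc G) := by
  intro l P' h
  generalize hP : Term.nil = P at h
  cases h <;> cases hP

theorem dead_guard {g : G.Guard 0 0} (hg : ¬ G.Holds g) (P : Proc G) : Dead (.guard g P) :=
  fun _ _ h => hg h.guard_inv.1

/-- Structural similarity of processes over two languages of guards, up to satisfied guards
and dead components. -/
inductive Rel : Proc G → Proc G' → Prop where
  | dead (P : Proc G) (Q : Proc G') : Dead P → Dead Q → Rel P Q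
  | inSum (r : ℕ) (n : Ref 0 0) (T : Fin (r + 1) → Term G 0 1) (U : Fin (r + 1) → Term G' 0 1) :
      (∀ i c, Rel ((T i).map (Ref.subst c)) ((U i).map (Ref.subst c))) →
      Rel (.inSum r n T) (.inSum r n U)
  | outSum (r : ℕ) (n : Ref 0 0) (m : Fin (r + 1) → Ref 0 0) (T : Fin (r + 1) → Proc G)
      (U : Fin (r + 1) → Proc G') :
      (∀ i, Rel (T i) (U i)) → Rel (.outSum r n m T) (.outSum r n m U)
  | par (P P' : Proc G) (Q Q' : Proc G') :
      Rel P Q → Rel P' Q' → Rel (.par P P') (.par Q Q')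
  | nu (c : Name) (P : Proc G) (Q : Proc G') : Rel P Q → Rel (Proc.nu c P) (Proc.nu c Q)
  | repIn (n : Ref 0 0) (T : Term G 0 1) (U : Term G' 0 1) :
      (∀ c, Rel (T.map (Ref.subst c)) (U.map (Ref.subst c))) → Rel (.repIn n T) (.repIn n U)
  | repOut (n m : Ref 0 0) (P : Proc G) (Q : Proc G') :
      Rel P Q → Rel (.repOut n m P) (.repOut n m Q)
  | guardL (g : G.Guard 0 0) (P : Proc G) (Q : Proc G') :
      G.Holds g → Rel P Q → Rel (.guard g P) Q
  | guardR (g : G'.Guard 0 0) (P : Proc G) (Q : Proc G') :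
      G'.Holds g → Rel P Q → Rel P (.guard g Q)
  | parDeadL (P D : Proc G) (Q : Proc G') : Dead D → Rel P Q → Rel (.par P D) Q
  | parDeadR (P : Proc G) (Q D : Proc G') : Dead D → Rel P Q → Rel P (.par Q D)
  | deadParL (P D : Proc G) (Q : Proc G') : Dead D → Rel P Q → Rel (.par D P) Q
  | deadParR (P : Proc G) (Q D : Proc G') : Dead D → Rel P Q → Rel P (.par D Q)

namespace Rel

theorem symm {P : Proc G} {Q : Proc G'} (h : Rel P Q) : Rel Q P := by
  induction h with
  | dead P Q h h' => exact dead _ _ h' h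
  | inSum r n T U _ ih => exact inSum _ _ _ _ ih
  | outSum r n m T U _ ih => exact outSum _ _ _ _ _ ih
  | par P P' Q Q' _ _ ih ih' => exact par _ _ _ _ ih ih'
  | nu c P Q _ ih => exact nu _ _ _ ih
  | repIn n T U _ ih => exact repIn _ _ _ ih
  | repOut n m P Q _ ih => exact repOut _ _ _ _ ih
  | guardL g P Q hg _ ih => exact guardR _ _ _ hg ih
  | guardR g P Q hg _ ih => exact guardL _ _ _ hg ih
  | parDeadL P D Q hD _ ih => exact parDeadR _ _ _ hD ih
  | parDeadR P Q D hD _ ih => exact parDeadL _ _ _ hD ih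
  | deadParL P D Q hD _ ih => exact deadParR _ _ _ hD ih
  | deadParR P Q D hD _ ih => exact deadParL _ _ _ hD ih

theorem rename (hG : G.Lawful) (hG' : G'.Lawful) (σ : Equiv.Perm Name) {P : Proc G}
    {Q : Proc G'} (h : Rel P Q) : Rel (P.rename σ) (Q.rename σ) := by
  induction h with
  | dead P Q h h' => exact dead _ _ (h.rename hG σ) (h'.rename hG' σ)
  | inSum r n T U _ ih =>
    simp only [Term.rename, Term.map, Ref.liftVar_rename]
    refine inSum _ _ _ _ fun i c => ?_
    -- Receiving c after the renaming corresponds to receiving its preimage before it.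
    have := ih i (σ.symm c)
    rwa [Term.rename_subst hG, Term.rename_subst hG', Equiv.apply_symm_apply] at this
  | outSum r n m T U _ ih => exact outSum _ _ _ _ _ ih
  | par P P' Q Q' _ _ ih ih' => exact par _ _ _ _ ih ih'
  | nu c P Q _ ih =>
    rw [Proc.rename_nu hG, Proc.rename_nu hG']
    exact nu _ _ _ ih
  | repIn n T U _ ih =>
    simp only [Term.rename, Term.map, Ref.liftVar_rename]
    refine repIn _ _ _ fun c => ?_
    have := ih (σ.symm c)
    rwa [Term.rename_subst hG, Term.rename_subst hG', Equiv.apply_symm_apply] at this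
  | repOut n m P Q _ ih => exact repOut _ _ _ _ ih
  | guardL g P Q hg _ ih => exact guardL _ _ _ ((hG.holds_rename σ g).2 hg) ih
  | guardR g P Q hg _ ih => exact guardR _ _ _ ((hG'.holds_rename σ g).2 hg) ih
  | parDeadL P D Q hD _ ih => exact parDeadL _ _ _ (hD.rename hG σ) ih
  | parDeadR P Q D hD _ ih => exact parDeadR _ _ _ (hD.rename hG' σ) ih
  | deadParL P D Q hD _ ih => exact deadParL _ _ _ (hD.rename hG σ) ih
  | deadParR P Q D hD _ ih => exact deadParR _ _ _ (hD.rename hG' σ) ih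

/-- The disjointness hypothesis is needed because Q may mention names absent from P, in guards or
dead components, and these could block a bound output that P performs. -/
theorem step (hG : G.Lawful) (hG' : G'.Lawful) {P : Proc G} {Q : Proc G'} (h : Rel P Q)
    {l : Action} {P' : Proc G} (hs : Step P l P') (hl : Disjoint l.bn Q.gn) :
    ∃ Q', Step Q l Q' ∧ Rel P' Q' := by
  induction h generalizing l P' with
  | dead P Q h h' => exact absurd hs (h _ _)
  | inSum r n T U h ih =>
    obtain ⟨a, c, i, rfl, rfl, rfl⟩ := hs.inSum_inv
    exact ⟨_, .inp _ _ _ _ i, h i c⟩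
  | outSum r n m T U h ih =>
    obtain ⟨a, c, i, rfl, rfl, rfl, rfl⟩ := hs.outSum_inv
    exact ⟨_, .out _ _ _ _ i, h i⟩
  | par P₁ P₂ Q₁ Q₂ h₁ h₂ ih₁ ih₂ =>
    obtain ⟨hl₁, hl₂⟩ := Finset.disjoint_union_right.1 hl
    rcases hs.par_inv with ⟨P', s, rfl⟩ | ⟨P', s, rfl⟩ | ⟨rfl, P₁', P₂', a, b, rfl, s⟩ |
      ⟨rfl, P₁', P₂', a, c, rfl, s⟩
    · obtain ⟨Q', hs', h'⟩ := ih₂ s hl₂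
      exact ⟨_, .parR _ _ _ _ hs' hl₁, .par _ _ _ _ h₁ h'⟩
    · obtain ⟨Q', hs', h'⟩ := ih₁ s hl₁
      exact ⟨_, .parL _ _ _ _ hs' hl₂, .par _ _ _ _ h' h₂⟩
    · rcases s with ⟨s₁, s₂⟩ | ⟨s₁, s₂⟩ <;>
      · obtain ⟨Q₁', t₁, r₁⟩ := ih₁ s₁ (Finset.disjoint_empty_left _)
        obtain ⟨Q₂', t₂, r₂⟩ := ih₂ s₂ (Finset.disjoint_empty_left _)
        first
        | exact ⟨_, .comL _ _ _ _ _ _ t₁ t₂, .par _ _ _ _ r₁ r₂⟩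
        | exact ⟨_, .comR _ _ _ _ _ _ t₁ t₂, .par _ _ _ _ r₁ r₂⟩
    -- The extruded name c may occur in the related processes. It is replaced by a d fresh for both
    -- sides, which meets the hypothesis on bound names and the side condition of the closing rule.
    · obtain ⟨d, hd⟩ := Infinite.exists_notMem_finset
        (P₁.gn ∪ P₂.gn ∪ (Q₁.gn ∪ Q₂.gn) ∪ (Proc.nu c (.par P₁' P₂')).gn ∪ {a})
      simp only [Finset.mem_union, Finset.mem_singleton, not_or] at hd
      obtain ⟨⟨⟨⟨d₁, d₂⟩, e₁, e₂⟩, d₃⟩, ha⟩ := hd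
      rw [← Proc.nu_swap hG d₃]
      rcases s with ⟨s₁, s₂, hc⟩ | ⟨s₁, s₂, hc⟩
      · have s₁' := s₁.inp_swap hG hc d₁ s₂.bout_ne (Ne.symm ha)
        have s₂' := s₂.bout_swap hG d₂ (Ne.symm ha)
        obtain ⟨Q₁', t₁, r₁⟩ := ih₁ s₁' (Finset.disjoint_empty_left _)
        obtain ⟨Q₂', t₂, r₂⟩ := ih₂ s₂' (by simpa [Action.bn] using e₂)
        exact ⟨_, .closeL _ _ _ _ _ _ t₁ t₂ e₁, .nu _ _ _ (.par _ _ _ _ r₁ r₂)⟩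
      · have s₂' := s₂.inp_swap hG hc d₂ s₁.bout_ne (Ne.symm ha)
        have s₁' := s₁.bout_swap hG d₁ (Ne.symm ha)
        obtain ⟨Q₁', t₁, r₁⟩ := ih₁ s₁' (by simpa [Action.bn] using e₁)
        obtain ⟨Q₂', t₂, r₂⟩ := ih₂ s₂' (Finset.disjoint_empty_left _)
        exact ⟨_, .closeR _ _ _ _ _ _ t₁ t₂ e₂, .nu _ _ _ (.par _ _ _ _ r₁ r₂)⟩
  | nu c P Q h ih =>
    -- The induction hypothesis concerns P, but inversion yields a transition of its swapped copy:
    -- conjugate by the swap.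
    have key : ∀ {d : Name} {l : Action} {T : Proc G},
        Step (P.rename (Equiv.swap c d)) l T → Disjoint l.bn (Q.rename (Equiv.swap c d)).gn →
        ∃ T', Step (Q.rename (Equiv.swap c d)) l T' ∧ Rel T T' := by
      intro d l T s hd
      have s' := s.rename hG (Equiv.swap c d)
      rw [Term.rename_swap_swap hG] at s'
      obtain ⟨U, t, r⟩ := ih s' (by
        rwa [← Term.rename_swap_swap hG' c d Q, disjoint_bn_rename hG'])
      have t' := t.rename hG' (Equiv.swap c d)
      have r' := r.rename hG hG' (Equiv.swap c d)
      rw [Action.rename_swap_swap] at t'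
      rw [Term.rename_swap_swap hG] at r'
      exact ⟨_, t', r'⟩
    rcases hs.nu_inv_fresh hG (Proc.nu c Q).gn with ⟨a, d, rfl, ha, -, s⟩ |
      ⟨d, T, hd, hdl, s, rfl⟩
    · obtain ⟨Q', t, r⟩ := key s (Finset.disjoint_empty_left _)
      rw [← Proc.nu_swap hG' (d := d) (by simpa [Action.bn] using hl)]
      exact ⟨_, .opn _ _ _ _ t ha, r⟩
    · have hn := Proc.nu_swap hG' hd
      -- A global name of the swapped Q is either d, which is not in the action, or a name of `nu c
      -- Q`, which is excluded by `hl`.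
      obtain ⟨Q', t, r⟩ := key s (Finset.disjoint_left.2 fun b hb hb' =>
        Finset.disjoint_left.1 hl hb (hn ▸ (Proc.mem_gn_nu hG' _ _ _).2
          ⟨hb', fun e => hdl (e ▸ l.bn_subset_names hb)⟩))
      rw [← hn]
      exact ⟨_, .res _ _ _ _ t hdl, .nu _ _ _ r⟩
  | repIn n T U h ih =>
    obtain ⟨a, b, rfl, rfl, rfl⟩ := hs.repIn_inv
    exact ⟨_, .repIn _ _ _, .par _ _ _ _ (h b) (.repIn _ _ _ h)⟩
  | repOut n m P Q h ih =>
    obtain ⟨a, b, rfl, rfl, rfl, rfl⟩ := hs.repOut_inv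
    exact ⟨_, .repOut _ _ _, .par _ _ _ _ h (.repOut _ _ _ _ h)⟩
  | guardL g P Q hg h ih => exact ih hs.guard_inv.2 hl
  | guardR g P Q hg h ih =>
    obtain ⟨hl₁, hl₂⟩ := Finset.disjoint_union_right.1 hl
    obtain ⟨Q', t, r⟩ := ih hs hl₂
    exact ⟨_, .guard _ _ _ _ hg t hl₁, r⟩
  | parDeadL P D Q hD h ih =>
    -- Every case except a move of P alone would need a transition of the dead component.
    rcases hs.par_inv with ⟨_, s, -⟩ | ⟨P', s, rfl⟩ | ⟨-, _, _, _, _, -, ⟨-, s⟩ | ⟨-, s⟩⟩ |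
      ⟨-, _, _, _, _, -, ⟨-, s, -⟩ | ⟨-, s, -⟩⟩
    case inr.inl =>
      obtain ⟨Q', t, r⟩ := ih s hl
      exact ⟨_, t, .parDeadL _ _ _ hD r⟩
    all_goals exact absurd s (hD _ _)
  | parDeadR P Q D hD h ih =>
    obtain ⟨hl₁, hl₂⟩ := Finset.disjoint_union_right.1 hl
    obtain ⟨Q', t, r⟩ := ih hs hl₁
    exact ⟨_, .parL _ _ _ _ t hl₂, .parDeadR _ _ _ hD r⟩
  | deadParL P D Q hD h ih =>
    rcases hs.par_inv with ⟨P', s, rfl⟩ | ⟨_, s, -⟩ | ⟨-, _, _, _, _, -, ⟨s, -⟩ | ⟨s, -⟩⟩ |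
      ⟨-, _, _, _, _, -, ⟨s, -, -⟩ | ⟨s, -, -⟩⟩
    case inl =>
      obtain ⟨Q', t, r⟩ := ih s hl
      exact ⟨_, t, .deadParL _ _ _ hD r⟩
    all_goals exact absurd s (hD _ _)
  | deadParR P Q D hD h ih =>
    obtain ⟨hl₁, hl₂⟩ := Finset.disjoint_union_right.1 hl
    obtain ⟨Q', t, r⟩ := ih hs hl₂
    exact ⟨_, .parR _ _ _ _ t hl₁, .deadParR _ _ _ hD r⟩

end Rel

/-! ### From labelled simulation to subbisimilarity -/

open Calculus

namespace Rel

theorem taus (hG : G.Lawful) (hG' : G'.Lawful) {P P' : Proc G} {Q : Proc G'} (h : Rel P Q)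
    (hP : (calculus G).Taus P P') : ∃ Q', (calculus G').Taus Q Q' ∧ Rel P' Q' := by
  induction hP with
  | refl => exact ⟨Q, .refl, h⟩
  | tail _ hs ih =>
    obtain ⟨Q₁, t, r⟩ := ih
    obtain ⟨Q', t', r'⟩ := r.step hG hG' hs (Finset.disjoint_empty_left _)
    exact ⟨Q', t.tail t', r'⟩

theorem observable (hG : G.Lawful) (hG' : G'.Lawful) {P : Proc G} {Q : Proc G'} (h : Rel P Q)
    (hP : (calculus G).Observable P) : (calculus G').Observable Q := by
  obtain ⟨P', P'', l, ht, hl, hs⟩ := hP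
  obtain ⟨Q', t, r⟩ := h.taus hG hG' ht
  -- Only that some visible action exists matters, so a bound output may first be given a name fresh
  -- for the other side.
  by_cases hb : ∃ a c, l = .bout a c
  · obtain ⟨a, c, rfl⟩ := hb
    obtain ⟨d, hd⟩ := Infinite.exists_notMem_finset
      (Term.gn (G := G) P' ∪ Term.gn (G := G') Q' ∪ {a})
    simp only [Finset.mem_union, Finset.mem_singleton, not_or] at hd
    obtain ⟨Q'', t', -⟩ := r.step hG hG' (Step.bout_swap hG hs hd.1.1 (Ne.symm hd.2))
      (by simpa [Action.bn] using hd.1.2)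
    exact ⟨Q', Q'', .bout a d, t, nofun, t'⟩
  · obtain ⟨Q'', t', -⟩ := r.step hG hG' hs (by
      cases l with
      | bout a c => exact absurd ⟨a, c, rfl⟩ hb
      | _ => exact Finset.disjoint_empty_left _)
    exact ⟨Q', Q'', l, t, hl, t'⟩

/-- An internal action binds no name, so `Rel.step` applies to it unconditionally; codivergence
already holds after one step, with k = 1. -/
theorem observational (hG : G.Lawful) (hG' : G'.Lawful) :
    Observational (L := calculus G) (M := calculus G') Rel := by
  refine ⟨fun P Q h => ⟨h.observable hG hG', h.symm.observable hG' hG⟩,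
    ⟨fun P Q P' Q' => .par P P' Q Q', fun c P Q => .nu c P Q⟩,
    fun P Q h => ⟨fun f hf => ?_, fun f hf => ?_⟩, fun P Q h => ⟨fun P' hs => ?_, fun Q' hs => ?_⟩⟩
  · obtain ⟨P', t, r⟩ := h.symm.step hG' hG (hf.1 ▸ hf.2 0 : (calculus G').Tau Q (f 1))
      (Finset.disjoint_empty_left _)
    exact ⟨1, le_rfl, P', .single t, r.symm⟩
  · obtain ⟨Q', t, r⟩ := h.step hG hG' (hf.1 ▸ hf.2 0 : (calculus G).Tau P (f 1))
      (Finset.disjoint_empty_left _)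
    exact ⟨1, le_rfl, Q', .single t, r⟩
  · obtain ⟨Q', t, r⟩ := h.step hG hG' hs (Finset.disjoint_empty_left _)
    exact .inr ⟨Q, Q', .refl, h, t, r⟩
  · obtain ⟨P', t, r⟩ := h.symm.step hG' hG hs (Finset.disjoint_empty_left _)
    exact .inr ⟨P, P', .refl, h, t, r.symm⟩

end Rel

/-- An observational relation that is total and onto is a subbisimilarity. -/
theorem Calculus.Observational.isSubbisimilarity {L M : Calculus} {R : L.Proc → M.Proc → Prop}
    (h : Observational R) (htot : ∀ P, ∃ Q, R P Q) (hsur : ∀ Q, ∃ P, R P Q) :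
    IsSubbisimilarity R where
  total := htot
  sound P₁ P₂ Q₁ Q₂ h₁ h₂ h₃ := by
    -- The witness is R⁻¹ ; =_L ; R; surjectivity of R is what makes it reflexive.
    refine ⟨_, fun Q => ?_, (h.symm.comp (AbsEq.isLargest L).1.2).comp h, P₂, ⟨P₁, h₁, h₂⟩, h₃⟩
    obtain ⟨P, hP⟩ := hsur Q
    exact ⟨P, ⟨P, hP, (AbsEq.isLargest L).1.1 P⟩, hP⟩
  observational := h

/-! ### Translations between the two calculi -/

/-- Replace the guards of a term by contexts. -/
def Term.trans (F : ∀ {k v : ℕ}, G.Guard k v → Term G' k v → Term G' k v) {k v : ℕ} :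
    Term G k v → Term G' k v
  | nil => nil
  | inSum r n T => inSum r n fun i => (T i).trans F
  | outSum r n m T => outSum r n m fun i => (T i).trans F
  | par S T => par (S.trans F) (T.trans F)
  | res T => res (T.trans F)
  | guard g T => F g (T.trans F)
  | repIn n T => repIn n (T.trans F)
  | repOut n m T => repOut n m (T.trans F)

section trans

variable {F : ∀ {k v : ℕ}, G.Guard k v → Term G' k v → Term G' k v}

/-- Quantifying over all closing maps ρ lets the induction pass under binders: substituting a
received name or opening a localization is absorbed into ρ. The translation acts on open terms, so F
must commute with maps, while its correctness `hR` is needed only for closed guards. -/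
theorem rel_trans (hG : G.Lawful) (hG' : G'.Lawful)
    (hF : ∀ {k v k' v' : ℕ} (ρ : Ref k v → Ref k' v') (g : G.Guard k v) (T : Term G' k v),
      (F g T).map ρ = F (G.map ρ g) (T.map ρ))
    (hR : ∀ (g : G.Guard 0 0) (P : Proc G) (Q : Proc G'), Rel P Q → Rel (.guard g P) (F g Q))
    {k v : ℕ} (T : Term G k v) (ρ : Ref k v → Ref 0 0) :
    Rel (T.map ρ) ((T.trans F).map ρ) := by
  induction T with
  | nil => exact .dead _ _ dead_nil dead_nil
  | inSum r n T ih =>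
    refine .inSum _ _ _ _ fun i c => ?_
    rw [Term.map_map hG, Term.map_map hG']
    exact ih i _
  | outSum r n m T ih => exact .outSum _ _ _ _ _ fun i => ih i ρ
  | par S T ih₁ ih₂ => exact .par _ _ _ _ (ih₁ ρ) (ih₂ ρ)
  | res T ih =>
    -- One name fresh for both bodies, so that both localizations open with the same name.
    obtain ⟨c, hc⟩ := Infinite.exists_notMem_finset
      ((T.map (Ref.liftLoc ρ)).gn ∪ ((T.trans F).map (Ref.liftLoc ρ)).gn)
    simp only [Finset.mem_union, not_or] at hc
    simp only [Term.map, Term.trans]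
    rw [Proc.exists_eq_nu hG hc.1, Proc.exists_eq_nu hG' hc.2, Term.map_map hG, Term.map_map hG']
    exact .nu _ _ _ (ih _)
  | guard g T ih =>
    simp only [Term.map, Term.trans, hF]
    exact hR _ _ _ (ih ρ)
  | repIn n T ih =>
    refine .repIn _ _ _ fun c => ?_
    rw [Term.map_map hG, Term.map_map hG']
    exact ih _
  | repOut n m T ih => exact .repOut _ _ _ _ (ih ρ)

theorem exists_rel (hG : G.Lawful) (hG' : G'.Lawful)
    (hF : ∀ {k v k' v' : ℕ} (ρ : Ref k v → Ref k' v') (g : G.Guard k v) (T : Term G' k v),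
      (F g T).map ρ = F (G.map ρ g) (T.map ρ))
    (hR : ∀ (g : G.Guard 0 0) (P : Proc G) (Q : Proc G'), Rel P Q → Rel (.guard g P) (F g Q))
    (P : Proc G) : ∃ Q : Proc G', Rel P Q := by
  have := rel_trans hG hG' hF hR P id
  rw [Term.map_id hG] at this
  exact ⟨_, this⟩

end trans

/-- A match or a mismatch as a Boolean expression. -/
def MatchGuard.toBoolExpr {k v : ℕ} : MatchGuard k v → BoolExpr k v
  | eq p q => .eq p q
  | ne p q => .not (.eq p q)

/-- The process that behaves as `S` if `φ` is true and as `T` otherwise. -/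
def branch {k v : ℕ} : BoolExpr k v → Term matchLang k v → Term matchLang k v → Term matchLang k v
  | .eq p q, S, T =>
    .par (.guard (G := matchLang) (MatchGuard.eq p q) S)
      (.guard (G := matchLang) (MatchGuard.ne p q) T)
  | .and φ ψ, S, T => branch φ (branch ψ S T) T
  | .not φ, S, T => branch φ T S

theorem map_branch {k v k' v' : ℕ} (ρ : Ref k v → Ref k' v') (φ : BoolExpr k v)
    (S T : Term matchLang k v) :
    (branch φ S T).map ρ = branch (φ.map ρ) (S.map ρ) (T.map ρ) := by
  induction φ generalizing S T with
  | eq p q => rfl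
  | and φ ψ ih₁ ih₂ => simp only [branch, BoolExpr.map, ih₁, ih₂]
  | not φ ih => simp only [branch, BoolExpr.map, ih]

/-- For an equality, one component is dead and the other has a true guard. For a conjunction T is
duplicated, but failure of the first or of the second conjunct selects a single copy. -/
theorem rel_branch {P : Proc G} (φ : BoolExpr 0 0) {S T : Proc matchLang}
    (hS : φ.Holds → Rel P S) (hT : ¬ φ.Holds → Rel P T) : Rel P (branch φ S T) := by
  induction φ generalizing S T with
  | eq p q =>
    by_cases h : p = q
    · exact .parDeadR _ _ _ (dead_guard (G := matchLang) (g := MatchGuard.ne p q)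
          (fun h' => h' h) _)
        (.guardR (G' := matchLang) _ _ _ h (hS h))
    · exact .deadParR _ _ _ (dead_guard (G := matchLang) (g := MatchGuard.eq p q) h _)
        (.guardR (G' := matchLang) _ _ _ h (hT h))
  | and φ ψ ih₁ ih₂ =>
    exact ih₁ (fun h₁ => ih₂ (fun h₂ => hS ⟨h₁, h₂⟩) fun h₂ => hT fun h => h₂ h.2)
      fun h₁ => hT fun h => h₁ h.1
  | not φ ih => exact ih (fun h => hT fun h' => h' h) hS

theorem exists_rel_piVee (P : Proc matchLang) : ∃ Q : Proc boolLang, Rel P Q := by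
  refine exists_rel (F := fun g T => .guard (G := boolLang) (MatchGuard.toBoolExpr g) T)
    matchLang_lawful boolLang_lawful (fun ρ g T => by cases g <;> rfl) (fun g P Q h => ?_) P
  have hg : boolLang.Holds (MatchGuard.toBoolExpr g) ↔ matchLang.Holds g := by
    cases g <;> exact Iff.rfl
  by_cases h' : matchLang.Holds g
  · exact .guardL _ _ _ h' (.guardR _ _ _ (hg.2 h') h)
  · exact .dead _ _ (dead_guard h' _) (dead_guard (hg.not.2 h') _)

theorem exists_rel_pi (P : Proc boolLang) : ∃ Q : Proc matchLang, Rel P Q := by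
  -- A guard is a conditional with the inert process as its else-branch.
  refine exists_rel (F := fun φ T => branch φ T .nil) boolLang_lawful
    matchLang_lawful (fun ρ φ T => map_branch ρ φ T .nil) (fun φ P Q h => ?_) P
  exact rel_branch φ (fun hφ => .guardL (G := boolLang) _ _ _ hφ h)
    fun hφ => .dead _ _ (dead_guard (G := boolLang) hφ _) dead_nil

end PiCalc

theorem mainTheorem7 :
    PiCalc.Calculus.Subbisimilar PiCalc.pi PiCalc.piVee ∧
      PiCalc.Calculus.Subbisimilar PiCalc.piVee PiCalc.pi := by
  open PiCalc in
  refine ⟨⟨Rel, (Rel.observational matchLang_lawful boolLang_lawful).isSubbisimilarity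
      exists_rel_piVee fun Q => ?_⟩,
    ⟨Rel, (Rel.observational boolLang_lawful matchLang_lawful).isSubbisimilarity
      exists_rel_pi fun Q => ?_⟩⟩
  · obtain ⟨P, h⟩ := exists_rel_pi Q
    exact ⟨P, h.symm⟩
  · obtain ⟨P, h⟩ := exists_rel_piVee Q
    exact ⟨P, h.symm⟩
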